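/- Let $d$ be a prime, $\omega=e^{2\pi i/d}$, and let $X|j\rangle=|j+1 \bmod d\rangle$, $Z|j\rangle=\omega^j|j\rangle$ on $\mathbb C^d$ with basis indexed by $\mathbb Z_d$. For $a,b\in\mathbb Z_d$ (represented in $\{0,\dots,d-1\}$) put $P_{(a|b)}=X^aZ^b$ if $d>2$ and $P_{(a|b)}=i^{ab}X^aZ^b$ if $d=2$, and for $k\in\mathbb Z_d$ let $$\Pi_{(a|b)[k]}=\frac1d\sum_{m=0}^{d-1}\omega^{-mk}P_{(a|b)}^m .$$ For $u=(u_1,\dots,u_{d+1})\in\mathbb Z_d^{d+1}$ define the phase-point operator $$A(u)=\frac1d\Big(\Pi_{(0|1)[u_1]}+\sum_{j=2}^{d+1}\Pi_{(1|j-2)[u_j]}-I\Big),$$ which is Hermitian. A stabilizer state is a unit vector that is fixed by every element of some cyclic group of order $d$ all of whose elements are of the form $\omega^cP_{(a|b)}$ with $a,b,c\in\mathbb Z_d$. Let $\rho$ be any qudit state (a positive semidefinite operator on $\mathbb C^d$ of trace $1$). Its negativity is $|N(\rho)|=0$ if $\mathrm{Tr}(\rho A(u))\ge 0$ for all $u$,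 and $|N(\rho)|=\big|\min_{u}\mathrm{Tr}(\rho A(u))\big|$ otherwise. Its robustness to depolarizing noise $p^\star(\rho)$ is the least $p\in[0,1]$ such that $(1-p)\rho+p\,I/d$ lies in the convex hull of the projectors $|\psi\rangle\langle\psi|$ onto stabilizer states $\psi$. Then this minimum is attained, and $$p^\star(\rho)=1-\frac{1}{d^2\,|N(\rho)|+1}.$$ -/

import Mathlib

open scoped Matrix ComplexOrder

noncomputable section

namespace QuditStab

/-- The primitive root of unity `ω = exp(2πi/d)`. -/
def omega (d : ℕ) : ℂ := Complex.exp (2 * Real.pi * Complex.I / d)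

lemma star_omega {d : ℕ} : star (omega d) * omega d = 1 := by
  rw [omega, Complex.star_def, ← Complex.exp_conj, ← Complex.exp_add, ← Complex.exp_zero]
  congr 1
  simp only [map_div₀, map_mul, map_ofNat, Complex.conj_ofReal, Complex.conj_I, map_natCast]
  ring

/-- Operators on a single qudit, in the computational basis indexed by `ℤ/d`. -/
abbrev Op (d : ℕ) : Type := Matrix (ZMod d) (ZMod d) ℂ

/-- The shift operator, `X|j⟩ = |j+1 mod d⟩`. -/
def shiftX (d : ℕ) : Op d := Matrix.of fun i j => if i = j + 1 then 1 else 0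

/-- The clock operator, `Z|j⟩ = ω^j |j⟩`. -/
def clockZ (d : ℕ) : Op d := Matrix.diagonal fun j => omega d ^ j.val

variable (d : ℕ) [Fact d.Prime]

/-- The Pauli operator `P_(a|b)`, equal to `X^a Z^b` for `d > 2` and to `i^(ab) σ_x^a σ_z^b`
for `d = 2`. -/
def pauli (a b : ZMod d) : Op d :=
  (if d = 2 then Complex.I ^ (a.val * b.val) else 1) • (shiftX d ^ a.val * clockZ d ^ b.val)

/-- The set `{ω^c P_(a|b)}` of single-qudit Pauli operators with their phases. -/
def pauliSet : Set (Op d) := {M | ∃ a b c : ZMod d, M = omega d ^ c.val • pauli d a b}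

/-- The projector `Π_(a|b)[k] = (1/d) ∑_{m<d} ω^(-mk) (P_(a|b))^m` onto the `ω^k` eigenspace of
`P_(a|b)`. -/
def proj (a b k : ZMod d) : Op d :=
  (1 / d : ℂ) • ∑ m ∈ Finset.range d, ((omega d ^ (m * k.val))⁻¹ : ℂ) • pauli d a b ^ m

/-- The phase-point operator `A(u)`, `u ∈ (ℤ/d)^(d+1)`. The coordinate `u 0` belongs to the
eigenbasis of `Z` and the coordinate `u (j+1)`, `0 ≤ j < d`, to the eigenbasis of `P_(1|j)`. -/
def phasePoint (u : Fin (d + 1) → ZMod d) : Op d :=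
  (1 / d : ℂ) • (proj d 0 1 (u 0) + ∑ j : Fin d, proj d 1 ((j : ℕ) : ZMod d) (u j.succ) - 1)

variable {d}

/-- A qudit state: a positive semidefinite operator of trace one. -/
def IsState (ρ : Op d) : Prop := ρ.PosSemidef ∧ ρ.trace = 1

/-- `ψ` is a (normalised) stabilizer state: the simultaneous eigenvector, with eigenvalue `1`, of a
group of `d` Pauli operators that is generated by one non-trivial element (and so is
commutative). -/
def IsStabilizerVector (ψ : ZMod d → ℂ) : Prop :=
  star ψ ⬝ᵥ ψ = 1 ∧
    ∃ S : Subgroup (Op d)ˣ,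
      (∀ g ∈ S, (g : Op d) ∈ pauliSet d) ∧ (∃ g, g ≠ 1 ∧ S = Subgroup.zpowers g) ∧
      Nat.card S = d ∧ ∀ g ∈ S, (g : Op d) *ᵥ ψ = ψ

variable (d) in
/-- The convex hull of the projectors `|ψ⟩⟨ψ|` onto stabilizer states. -/
def stabilizerHull : Set (Op d) :=
  convexHull ℝ {M | ∃ ψ : ZMod d → ℂ, IsStabilizerVector ψ ∧ M = Matrix.vecMulVec ψ (star ψ)}

/-- The Wigner value `Tr(ρ A(u))`; it is a real number for every state, see
`wigner_eq_trace` below. -/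
def wigner (ρ : Op d) (u : Fin (d + 1) → ZMod d) : ℝ := (ρ * phasePoint d u).trace.re

open scoped Classical in
/-- The negativity `|N(ρ)|`. -/
def negativity (ρ : Op d) : ℝ :=
  if ∀ u, 0 ≤ wigner ρ u then 0
  else |Finset.univ.inf' Finset.univ_nonempty (wigner ρ)|

/-- The depolarized state `(1 - p) ρ + p I/d`. -/
def depolarize (p : ℝ) (ρ : Op d) : Op d := (1 - p) • ρ + p • ((1 / d : ℂ) • (1 : Op d))

/-- The noise rates `p ∈ [0,1]` that bring `ρ` into the convex hull of stabilizer states. -/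
def stabilizingRates (ρ : Op d) : Set ℝ :=
  {p | 0 ≤ p ∧ p ≤ 1 ∧ depolarize p ρ ∈ stabilizerHull d}

/-- The robustness `p*(ρ)` to depolarizing noise. -/
def robustness (ρ : Op d) : ℝ := sInf (stabilizingRates ρ)

section Real

lemma omega_pow_d : omega d ^ d = 1 := by
  have hd : (d : ℂ) ≠ 0 := by exact_mod_cast (Fact.out : d.Prime).ne_zero
  rw [omega, ← Complex.exp_nat_mul, mul_div_cancel₀ _ hd, Complex.exp_two_pi_mul_I]

lemma omega_val_add_one (j : ZMod d) : omega d ^ (j + 1).val = omega d * omega d ^ j.val := by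
  have : Fact (1 < d) := ⟨(Fact.out : d.Prime).one_lt⟩
  rw [← pow_succ', ZMod.val_add, ZMod.val_one, ← pow_eq_pow_mod _ omega_pow_d]

lemma shiftX_pow (n : ℕ) :
    shiftX d ^ n = Matrix.of fun i j : ZMod d => if i = j + n then (1 : ℂ) else 0 := by
  induction n with
  | zero => ext i j; simp [Matrix.one_apply]
  | succ n ih =>
    rw [pow_succ, ih]
    ext i j
    simp only [Matrix.mul_apply, shiftX, Matrix.of_apply, mul_ite, mul_one, mul_zero,
      Finset.sum_ite_eq', Finset.mem_univ, if_true, Nat.cast_succ]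
    rw [show j + 1 + (n : ZMod d) = j + (n + 1) by ring]

lemma shiftX_pow_d : shiftX d ^ d = 1 := by
  rw [shiftX_pow]; ext i j; simp [Matrix.one_apply]

lemma clockZ_pow_d : clockZ d ^ d = 1 := by
  rw [clockZ, Matrix.diagonal_pow, ← Matrix.diagonal_one]
  congr 1
  ext j
  simp only [Pi.pow_apply]
  rw [← pow_mul, mul_comm, pow_mul, omega_pow_d, one_pow]

lemma clockZ_mul_shiftX : clockZ d * shiftX d = omega d • (shiftX d * clockZ d) := by
  ext i j
  by_cases h : i = j + 1
  · subst h
    simp [clockZ, shiftX, Matrix.diagonal_mul, Matrix.mul_diagonal, omega_val_add_one]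
  · simp [clockZ, shiftX, Matrix.diagonal_mul, Matrix.mul_diagonal, h]

lemma qcomm_pow {A B : Op d} {q : ℂ} (h : B * A = q • (A * B)) (n : ℕ) :
    B ^ n * A = q ^ n • (A * B ^ n) := by
  induction n with
  | zero => simp
  | succ n ih =>
    rw [pow_succ, mul_assoc, h, mul_smul_comm, ← mul_assoc, ih, smul_mul_assoc, smul_smul,
      mul_assoc, pow_succ']

lemma qcomm_pow' {A B : Op d} {q : ℂ} (h : B * A = q • (A * B)) (n : ℕ) :
    B * A ^ n = q ^ n • (A ^ n * B) := by
  induction n with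
  | zero => simp
  | succ n ih =>
    rw [pow_succ, ← mul_assoc, ih, smul_mul_assoc, mul_assoc, h, mul_smul_comm, smul_smul,
      ← mul_assoc, pow_succ q]

lemma mul_pow_qcomm {A B : Op d} {q : ℂ} (h : B * A = q • (A * B)) (n : ℕ) :
    (A * B) ^ n = q ^ n.choose 2 • (A ^ n * B ^ n) := by
  induction n with
  | zero => simp
  | succ n ih =>
    rw [pow_succ, ih, smul_mul_assoc, mul_assoc (A ^ n), ← mul_assoc (B ^ n), qcomm_pow h,
      smul_mul_assoc, mul_smul_comm, smul_smul, ← pow_add, mul_assoc A, ← mul_assoc (A ^ n),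
      ← pow_succ, ← pow_succ, Nat.choose_succ_succ' n 1, Nat.choose_one_right,
      add_comm n (n.choose (1 + 1))]

lemma pauli_pow_d (a b : ZMod d) : pauli d a b ^ d = 1 := by
  have h : clockZ d ^ b.val * shiftX d ^ a.val =
      (omega d ^ b.val) ^ a.val • (shiftX d ^ a.val * clockZ d ^ b.val) :=
    qcomm_pow' (qcomm_pow clockZ_mul_shiftX _) _
  have hX : (shiftX d ^ a.val) ^ d = 1 := by
    rw [← pow_mul, mul_comm, pow_mul, shiftX_pow_d, one_pow]
  have hZ : (clockZ d ^ b.val) ^ d = 1 := by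
    rw [← pow_mul, mul_comm, pow_mul, clockZ_pow_d, one_pow]
  rw [pauli, smul_pow, mul_pow_qcomm h, hX, hZ, mul_one, smul_smul]
  convert one_smul ℂ (1 : Op d)
  split_ifs with h2
  · subst h2
    have hw : omega 2 = -1 := by
      have : (2 * Real.pi * Complex.I / (2 : ℕ) : ℂ) = Real.pi * Complex.I := by
        push_cast; ring
      rw [omega, this, Complex.exp_pi_mul_I]
    rw [hw, ← pow_mul (-1 : ℂ), mul_comm b.val, ← pow_mul, mul_comm _ 2, pow_mul, Complex.I_sq,
      Nat.choose_self, pow_one, ← mul_pow]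
    norm_num
  · obtain ⟨r, hr⟩ : d ∣ d.choose 2 :=
      (Fact.out : d.Prime).dvd_choose_self two_ne_zero
        (lt_of_le_of_ne (Fact.out : d.Prime).two_le (Ne.symm h2))
    rw [one_pow, one_mul, hr, ← pow_mul, ← pow_mul]
    rw [show b.val * (a.val * (d * r)) = d * (b.val * a.val * r) by ring, pow_mul, omega_pow_d,
      one_pow]

lemma shiftX_unitary : star (shiftX d) * shiftX d = 1 := by
  ext i j
  simp [Matrix.mul_apply, shiftX, Matrix.star_apply, Matrix.one_apply, eq_comm]

lemma clockZ_unitary : star (clockZ d) * clockZ d = 1 := by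
  rw [clockZ, Matrix.star_eq_conjTranspose, Matrix.diagonal_conjTranspose,
    Matrix.diagonal_mul_diagonal, ← Matrix.diagonal_one]
  congr 1
  ext j
  simp only [Pi.star_apply, star_pow]
  rw [← mul_pow, star_omega, one_pow]

lemma star_mul_self_mul {A B : Op d} (hA : star A * A = 1) (hB : star B * B = 1) :
    star (A * B) * (A * B) = 1 := by
  rw [star_mul, mul_assoc, ← mul_assoc (star A), hA, one_mul, hB]

lemma star_mul_self_pow {A : Op d} (hA : star A * A = 1) (n : ℕ) :
    star (A ^ n) * A ^ n = 1 := by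
  induction n with
  | zero => simp
  | succ n ih => rw [pow_succ]; exact star_mul_self_mul ih hA

lemma star_mul_self_smul {A : Op d} (hA : star A * A = 1) {c : ℂ} (hc : star c * c = 1) :
    star (c • A) * (c • A) = 1 := by
  rw [star_smul, smul_mul_smul_comm, hA, hc, one_smul]

lemma pauli_unitary (a b : ZMod d) : star (pauli d a b) * pauli d a b = 1 := by
  refine star_mul_self_smul (star_mul_self_mul (star_mul_self_pow shiftX_unitary _)
    (star_mul_self_pow clockZ_unitary _)) ?_
  split_ifs
  · rw [star_pow, ← mul_pow]; simp
  · simp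

lemma proj_isHermitian (a b k : ZMod d) : (proj d a b k).IsHermitian := by
  obtain ⟨V, hV, hVd, hP⟩ : ∃ V : Op d, star V * V = 1 ∧ V ^ d = 1 ∧
      proj d a b k = (1 / d : ℂ) • ∑ m ∈ Finset.range d, V ^ m := by
    have hw := star_omega (d := d)
    have hw' : star ((omega d ^ k.val)⁻¹) * (omega d ^ k.val)⁻¹ = 1 := by
      rw [star_inv₀, ← mul_inv, star_pow, ← mul_pow, hw, one_pow, inv_one]
    refine ⟨(omega d ^ k.val)⁻¹ • pauli d a b, star_mul_self_smul (pauli_unitary a b) hw', ?_, ?_⟩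
    · rw [smul_pow, pauli_pow_d, inv_pow, ← pow_mul, mul_comm, pow_mul, omega_pow_d]
      simp
    · rw [proj]
      congr 1
      refine Finset.sum_congr rfl fun m _ => ?_
      rw [smul_pow, inv_pow, ← pow_mul, mul_comm m]
  have key : ∀ m ∈ Finset.range d, star (V ^ m) = V ^ (d - 1 - m + 1) := by
    intro m hm
    have hm' : d - 1 - m + 1 = d - m := by have := Finset.mem_range.1 hm; omega
    have hm'' : m ≤ d := (Finset.mem_range.1 hm).le
    calc star (V ^ m) = star (V ^ m) * (V ^ m * V ^ (d - m)) := by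
          rw [← pow_add, Nat.add_sub_cancel' hm'', hVd, mul_one]
      _ = V ^ (d - 1 - m + 1) := by
          rw [← mul_assoc, star_mul_self_pow hV, one_mul, hm']
  rw [Matrix.IsHermitian, ← Matrix.star_eq_conjTranspose, hP, star_smul, star_sum,
    Finset.sum_congr rfl key, Finset.sum_range_reflect (fun m => V ^ (m + 1)) d]
  have h1 := Finset.sum_range_succ (fun m => V ^ m) d
  rw [Finset.sum_range_succ', hVd, pow_zero] at h1
  rw [add_right_cancel h1]
  simp

lemma phasePoint_isHermitian (u : Fin (d + 1) → ZMod d) : (phasePoint d u).IsHermitian := by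
  have h : (proj d 0 1 (u 0) + ∑ j : Fin d, proj d 1 ((j : ℕ) : ZMod d) (u j.succ) - 1 :
      Op d).IsHermitian := by
    refine ((proj_isHermitian _ _ _).add ?_).sub Matrix.isHermitian_one
    rw [Matrix.IsHermitian, Matrix.conjTranspose_sum]
    exact Finset.sum_congr rfl fun j _ => proj_isHermitian _ _ _
  rw [Matrix.IsHermitian, phasePoint, Matrix.conjTranspose_smul, h]
  simp

lemma wigner_eq_trace {ρ : Op d} (hρ : IsState ρ) (u : Fin (d + 1) → ZMod d) :
    (wigner ρ u : ℂ) = (ρ * phasePoint d u).trace := by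
  refine Complex.conj_eq_iff_re.1 ?_
  rw [← Complex.star_def, ← Matrix.trace_conjTranspose, Matrix.conjTranspose_mul,
    phasePoint_isHermitian u, hρ.1.isHermitian, Matrix.trace_mul_comm]

end Real

end QuditStab

end

noncomputable section

namespace QuditStab

variable {d : ℕ} [Fact d.Prime]

-- The `d + 1` Pauli labels `basisLabel i` represent the lines through the origin of the plane
-- `(ℤ/d)²`, and their eigenbases are mutually unbiased. Every stabilizer projector is one of the
-- `d(d+1)` projectors `basisProj i k`, and conversely (`stabilizerHull_eq`). Since the lines cover
-- the plane and meet only at the origin, expanding in Weyl operators gives the frame identity `∑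
-- Tr(M Π_{i,k}) Π_{i,k} = M + Tr(M) I` (`sum_trace_basisProj_smul`).
--
-- This identity shows that the phase-point inequalities cut out the stabilizer hull among Hermitian
-- operators of trace one. They hold at each vertex by unbiasedness. Conversely, the frame
-- coefficients represent `M + I`; because `∑ₖ Π_{i,k} = I`, they may be shifted by a constant in
-- each basis, and `Tr(M A(u)) ≥ 0` at the basiswise minimizers `u` says that shifts of total `-1`
-- can keep all of them nonnegative (`mem_stabilizerHull_of_wigner_nonneg`).
--
-- Depolarizing sends a Wigner value `W` to `(1 - p) W + p / d²`. The most negative value `-n` is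
-- the last to become nonnegative, at `p = d² n / (d² n + 1)`.

local notation "χ" => (ZMod.stdAddChar : AddChar (ZMod _) ℂ)

/-! ### The additive character of `ℤ/d` -/

lemma omega_pow_eq_stdAddChar (n : ℕ) : omega d ^ n = χ (n : ZMod d) := by
  rw [omega, ← Complex.exp_nat_mul]
  have := ZMod.stdAddChar_coe (N := d) (n : ℤ)
  rw [Int.cast_natCast] at this
  rw [this]
  congr 1
  push_cast
  ring

lemma star_stdAddChar (x : ZMod d) : star (χ x) = χ (-x) :=
  (AddChar.map_neg_eq_conj _ x).symm

lemma stdAddChar_neg_mul_self (x : ZMod d) : χ (-x) * χ x = 1 := by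
  rw [← AddChar.map_add_eq_mul, neg_add_cancel, AddChar.map_zero_eq_one]

lemma sum_stdAddChar_mul (b : ZMod d) : ∑ x, χ (x * b) = if b = 0 then (d : ℂ) else 0 := by
  rw [AddChar.sum_mulShift b (ZMod.isPrimitive_stdAddChar d), ZMod.card]
  split_ifs <;> simp

lemma sum_range_eq_sum_zmod {M : Type*} [AddCommMonoid M] (f : ZMod d → M) :
    ∑ n ∈ Finset.range d, f n = ∑ j, f j := by
  refine Finset.sum_nbij' (fun n => (n : ZMod d)) ZMod.val (by simp)
    (fun j _ => Finset.mem_range.2 (ZMod.val_lt j)) ?_ (by simp) (by simp)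
  intro n hn
  exact ZMod.val_cast_of_lt (Finset.mem_range.1 hn)

lemma natCast_ne_zero_complex : (d : ℂ) ≠ 0 := by
  exact_mod_cast (Fact.out : d.Prime).ne_zero

/-! ### Weyl operators and the phases of Pauli powers -/

/-- The Weyl operator `X^a Z^b`, by its matrix entries. -/
def weyl (a b : ZMod d) : Op d := Matrix.of fun x y => if x = y + a then χ (b * y) else 0

lemma weyl_apply (a b x y : ZMod d) : weyl a b x y = if x = y + a then χ (b * y) else 0 := rfl

lemma weyl_mul (a b a' b' : ZMod d) :
    weyl a b * weyl a' b' = χ (b * a') • weyl (a + a') (b + b') := by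
  ext x y
  simp only [Matrix.mul_apply, weyl_apply, Matrix.smul_apply, mul_ite, mul_zero,
    Finset.sum_ite_eq', Finset.mem_univ, if_true, smul_eq_mul]
  rw [show y + (a + a') = y + a' + a by ring, ite_mul, zero_mul, ← AddChar.map_add_eq_mul,
    ← AddChar.map_add_eq_mul]
  congr 2
  ring

lemma weyl_zero_zero : weyl (0 : ZMod d) 0 = 1 := by
  ext x y
  simp [weyl_apply, Matrix.one_apply]

lemma weyl_mul_comm (a b a' b' : ZMod d) :
    weyl a b * weyl a' b' = χ (b * a' - b' * a) • (weyl a' b' * weyl a b) := by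
  rw [weyl_mul, weyl_mul, smul_smul, ← AddChar.map_add_eq_mul, sub_add_cancel, add_comm a',
    add_comm b']

lemma trace_weyl (a b : ZMod d) :
    (weyl a b).trace = if a = 0 ∧ b = 0 then (d : ℂ) else 0 := by
  by_cases ha : a = 0
  · have := sum_stdAddChar_mul b
    simp only [mul_comm] at this
    simpa [Matrix.trace, weyl_apply, ha] using this
  · simp [Matrix.trace, weyl_apply, ha]

lemma shiftX_pow_mul_clockZ_pow (a b : ZMod d) :
    shiftX d ^ a.val * clockZ d ^ b.val = weyl a b := by
  rw [shiftX_pow, clockZ, Matrix.diagonal_pow]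
  ext x y
  simp [Matrix.mul_diagonal, weyl_apply, omega_pow_eq_stdAddChar, ← AddChar.map_nsmul_eq_pow]

lemma exists_pauli_eq_smul_weyl (a b : ZMod d) :
    ∃ c : ℂ, star c * c = 1 ∧ pauli d a b = c • weyl a b := by
  refine ⟨_, ?_, by rw [pauli, shiftX_pow_mul_clockZ_pow]⟩
  split_ifs
  · rw [star_pow, ← mul_pow]; simp
  · simp

/-- The phase stays existential: only its modulus matters below, which lets `d = 2` and odd `d` be
treated together. -/
lemma exists_smul_weyl_pow (c : ℂ) (hc : star c * c = 1) (a b : ZMod d) (m : ℕ) :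
    ∃ e : ℂ, star e * e = 1 ∧ (c • weyl a b) ^ m = e • weyl ((m : ZMod d) * a) ((m : ZMod d) * b) := by
  induction m with
  | zero => exact ⟨1, by simp, by simp [weyl_zero_zero]⟩
  | succ m ih =>
    obtain ⟨e, he, h⟩ := ih
    refine ⟨e * c * χ ((m : ZMod d) * b * a), ?_, ?_⟩
    · have h1 : star (χ ((m : ZMod d) * b * a)) * χ ((m : ZMod d) * b * a) = 1 := by
        rw [star_stdAddChar, stdAddChar_neg_mul_self]
      rw [star_mul', star_mul']
      linear_combination (star c * c * (star (χ ((m : ZMod d) * b * a)) * χ ((m : ZMod d) * b * a))) * he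
        + (star (χ ((m : ZMod d) * b * a)) * χ ((m : ZMod d) * b * a)) * hc + h1
    · rw [pow_succ, h, smul_mul_smul_comm, weyl_mul, smul_smul]
      congr 2 <;> push_cast <;> ring

lemma exists_pauli_pow_eq_smul_weyl (a b : ZMod d) (m : ℕ) :
    ∃ c : ℂ, star c * c = 1 ∧ pauli d a b ^ m =
      c • weyl ((m : ZMod d) * a) ((m : ZMod d) * b) := by
  obtain ⟨c, hc, h⟩ := exists_pauli_eq_smul_weyl a b
  rw [h]
  exact exists_smul_weyl_pow c hc a b m

lemma proj_eq_sum (a b k : ZMod d) :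
    proj d a b k = (1 / d : ℂ) • ∑ m : ZMod d, χ (-(m * k)) • pauli d a b ^ m.val := by
  rw [proj, ← sum_range_eq_sum_zmod]
  congr 1
  refine Finset.sum_congr rfl fun m hm => ?_
  rw [ZMod.val_cast_of_lt (Finset.mem_range.1 hm), omega_pow_eq_stdAddChar,
    AddChar.map_neg_eq_inv]
  simp

/-! ### Weyl expansion and the frame identity -/

lemma trace_mul_conjTranspose_weyl (M : Op d) (a b : ZMod d) :
    (M * (weyl a b)ᴴ).trace = ∑ y, M (y + a) y * χ (-(b * y)) := by
  simp only [Matrix.trace, Matrix.diag, Matrix.mul_apply, Matrix.conjTranspose_apply, weyl_apply]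
  rw [Finset.sum_comm]
  refine Finset.sum_congr rfl fun y _ => ?_
  rw [Finset.sum_eq_single (y + a) (fun z _ hz => by simp [hz]) (by simp), if_pos rfl,
    star_stdAddChar]

/-- The Weyl operators form an orthogonal basis of squared norm `d`. Entrywise, the shift must be `x
- y`, and character orthogonality in `b` isolates one matrix entry. -/
lemma sum_trace_smul_weyl (M : Op d) :
    ∑ a, ∑ b, (M * (weyl a b)ᴴ).trace • weyl a b = (d : ℂ) • M := by
  ext x y
  simp only [Matrix.sum_apply, Matrix.smul_apply, smul_eq_mul, trace_mul_conjTranspose_weyl,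
    weyl_apply]
  rw [Finset.sum_eq_single (x - y) (fun a _ ha => Finset.sum_eq_zero fun b _ => by
    rw [if_neg fun h => ha (by rw [h]; ring), mul_zero]) (by simp)]
  simp only [add_sub_cancel, if_true, Finset.sum_mul]
  rw [Finset.sum_comm]
  have key : ∀ z b : ZMod d, M (z + (x - y)) z * χ (-(b * z)) * χ (b * y) =
      M (z + (x - y)) z * χ (b * (y - z)) := fun z b => by
    rw [mul_assoc, ← AddChar.map_add_eq_mul]
    congr 2
    ring
  simp only [key, ← Finset.mul_sum, sum_stdAddChar_mul]
  rw [Finset.sum_eq_single y (fun z _ hz => by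
    rw [if_neg fun h => hz (sub_eq_zero.1 h).symm, mul_zero]) (by simp)]
  simp [mul_comm]

/-- Parseval along the line spanned by `(a, b)`: as functions of `k` the projectors are the Fourier
transform of the Pauli powers. -/
lemma sum_trace_proj_smul_proj (M : Op d) (a b : ZMod d) :
    ∑ k, (M * proj d a b k).trace • proj d a b k =
      (1 / d : ℂ) • ∑ m : ZMod d, (M * (weyl (m * a) (m * b))ᴴ).trace • weyl (m * a) (m * b) := by
  have hd := natCast_ne_zero_complex (d := d)
  have h1 : ∀ k, (M * proj d a b k).trace =
      (1 / d : ℂ) * ∑ m : ZMod d, χ (m * k) * (M * (pauli d a b ^ m.val)ᴴ).trace := fun k => by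
    -- Expanding the adjoint of the projector gives the conjugate characters, so that the sum over
    -- `k` becomes an orthogonality relation.
    rw [← proj_isHermitian a b k, proj_eq_sum]
    simp only [Matrix.conjTranspose_smul, Matrix.conjTranspose_sum, Matrix.mul_smul,
      Matrix.mul_sum, Matrix.trace_smul, Matrix.trace_sum, smul_eq_mul, star_stdAddChar, neg_neg]
    simp
  -- The unknown phase appears once conjugated and once not, so it cancels.
  have h2 : ∀ m : ZMod d, (M * (pauli d a b ^ m.val)ᴴ).trace • pauli d a b ^ m.val =
      (M * (weyl (m * a) (m * b))ᴴ).trace • weyl (m * a) (m * b) := fun m => by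
    obtain ⟨c, hc, h⟩ := exists_pauli_pow_eq_smul_weyl a b m.val
    rw [ZMod.natCast_zmod_val] at h
    rw [h, Matrix.conjTranspose_smul, Matrix.mul_smul, Matrix.trace_smul, smul_smul, smul_eq_mul,
      mul_right_comm, hc, one_mul]
  simp only [← h2, h1]
  simp only [proj_eq_sum, Finset.smul_sum, smul_smul, Finset.mul_sum, Finset.sum_mul,
    Finset.sum_smul]
  rw [Finset.sum_comm]
  refine Finset.sum_congr rfl fun m' _ => ?_
  rw [Finset.sum_comm]
  have key : ∀ m k : ZMod d,
      1 / (d : ℂ) * (χ (m * k) * (M * (pauli d a b ^ m.val)ᴴ).trace) *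
        (1 / d * χ (-(m' * k))) = 1 / d * (1 / d) * (M * (pauli d a b ^ m.val)ᴴ).trace *
        χ (k * (m - m')) := fun m k => by
    rw [show k * (m - m') = m * k + -(m' * k) by ring, AddChar.map_add_eq_mul]
    ring
  simp only [key, ← Finset.sum_smul, ← Finset.mul_sum, sum_stdAddChar_mul]
  rw [Finset.sum_eq_single m' (fun z _ hz => by
    rw [if_neg fun h => hz (sub_eq_zero.1 h), mul_zero]) (by simp)]
  rw [if_pos (sub_self _)]
  congr 1
  field_simp

/-- The labels of the `d + 1` Pauli operators whose eigenbases are used by `phasePoint`. -/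
def basisLabel : Fin (d + 1) → ZMod d × ZMod d := Fin.cons (0, 1) fun j => (1, ((j : ℕ) : ZMod d))

/-- The projectors onto the vectors of the `d + 1` mutually unbiased bases. -/
def basisProj (i : Fin (d + 1)) (k : ZMod d) : Op d :=
  proj d (basisLabel i).1 (basisLabel i).2 k

lemma phasePoint_eq (u : Fin (d + 1) → ZMod d) :
    phasePoint d u = (1 / d : ℂ) • (∑ i, basisProj i (u i) - 1) := by
  rw [phasePoint, Fin.sum_univ_succ]
  rfl

/-- Summing over all `d + 1` lines counts each nonzero point of the plane once and the origin `d +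
1` times. The full Weyl sum accounts for one of these; the `d` extra copies of the origin give the
trace term. -/
lemma sum_trace_basisProj_smul (M : Op d) :
    ∑ i, ∑ k, (M * basisProj i k).trace • basisProj i k = M + M.trace • (1 : Op d) := by
  have hd := natCast_ne_zero_complex (d := d)
  set F : ZMod d → ZMod d → Op d := fun a b => (M * (weyl a b)ᴴ).trace • weyl a b with hF
  have h0 : F 0 0 = M.trace • (1 : Op d) := by simp [hF, weyl_zero_zero]
  simp only [basisProj, sum_trace_proj_smul_proj, ← Finset.smul_sum]
  rw [Fin.sum_univ_succ]
  simp only [basisLabel, Fin.cons_zero, Fin.cons_succ, mul_zero, mul_one]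
  have h1 : ∑ j : Fin d, ∑ m : ZMod d, F m (m * ((j : ℕ) : ZMod d)) =
      ∑ m, ∑ b, F m (m * b) := by
    rw [Finset.sum_comm]
    refine Finset.sum_congr rfl fun m _ => ?_
    rw [← sum_range_eq_sum_zmod fun b => F m (m * b),
      Fin.sum_univ_eq_sum_range fun n => F m (m * (n : ZMod d))]
  -- For `m ≠ 0`, multiplication by `m` permutes `ℤ/d`, so the slopes sweep out the whole column
  -- over `m`.
  have h2 : ∀ m ∈ Finset.univ.erase (0 : ZMod d), ∑ b, F m (m * b) = ∑ b, F m b := fun m hm =>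
    Fintype.sum_equiv (Equiv.mulLeft₀ m (Finset.ne_of_mem_erase hm)) _ _ fun _ => rfl
  have h3 : ∑ a, ∑ b, F a b = (d : ℂ) • M := sum_trace_smul_weyl M
  rw [← Finset.add_sum_erase _ _ (Finset.mem_univ (0 : ZMod d))] at h1 h3
  rw [Finset.sum_congr rfl h2] at h1
  change (1 / d : ℂ) • (∑ m, F 0 m + ∑ j : Fin d, ∑ m : ZMod d, F m (m * ((j : ℕ) : ZMod d))) = _
  rw [h1, add_left_comm, h3]
  simp only [zero_mul, Finset.sum_const, Finset.card_univ, ZMod.card, h0]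
  rw [← Nat.cast_smul_eq_nsmul ℂ, ← smul_add, smul_smul, one_div, inv_mul_cancel₀ hd, one_smul,
    add_comm]

/-! ### Pauli eigenvectors and mutual unbiasedness -/

lemma trace_vecMulVec_star_mul (ψ : ZMod d → ℂ) (M : Op d) :
    (Matrix.vecMulVec ψ (star ψ) * M).trace = star ψ ⬝ᵥ (M *ᵥ ψ) := by
  rw [Matrix.vecMulVec_mul, Matrix.trace_vecMulVec, dotProduct_comm, Matrix.dotProduct_mulVec]

lemma star_mulVec_dotProduct_mulVec {U : Op d} (hU : star U * U = 1) (v w : ZMod d → ℂ) :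
    star (U *ᵥ v) ⬝ᵥ (U *ᵥ w) = star v ⬝ᵥ w := by
  rw [Matrix.star_mulVec, ← Matrix.dotProduct_mulVec, Matrix.mulVec_mulVec,
    ← Matrix.star_eq_conjTranspose, hU, Matrix.one_mulVec]

lemma pow_mulVec_eigenvector {M : Op d} {ψ : ZMod d → ℂ} {l : ℂ} (h : M *ᵥ ψ = l • ψ) (n : ℕ) :
    M ^ n *ᵥ ψ = l ^ n • ψ := by
  induction n with
  | zero => simp
  | succ n ih => rw [pow_succ, ← Matrix.mulVec_mulVec, h, Matrix.mulVec_smul, ih, smul_smul,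
      pow_succ']

/-- Applying the unitary Pauli operator to both arguments leaves the expectation unchanged, yet
commuting it past the Weyl operator produces a nontrivial character value. So the expectation
vanishes. -/
lemma expectation_weyl_eq_zero {ψ : ZMod d → ℂ} (hψ : star ψ ⬝ᵥ ψ = 1) {a b a' b' : ZMod d} {l : ℂ}
    (h : pauli d a b *ᵥ ψ = l • ψ) (hab : b * a' - b' * a ≠ 0) :
    star ψ ⬝ᵥ (weyl a' b' *ᵥ ψ) = 0 := by
  have hl : star l * l = 1 := by
    have := star_mulVec_dotProduct_mulVec (pauli_unitary a b) ψ ψ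
    rw [h, star_smul, smul_dotProduct, dotProduct_smul, hψ] at this
    simpa using this
  obtain ⟨c, -, hP⟩ := exists_pauli_eq_smul_weyl a b
  have hcomm : pauli d a b * weyl a' b' = χ (b * a' - b' * a) • (weyl a' b' * pauli d a b) := by
    rw [hP, smul_mul_assoc, weyl_mul_comm, mul_smul_comm, smul_comm]
  have h1 : pauli d a b *ᵥ (weyl a' b' *ᵥ ψ) = (χ (b * a' - b' * a) * l) • (weyl a' b' *ᵥ ψ) := by
    rw [Matrix.mulVec_mulVec, hcomm, Matrix.smul_mulVec, ← Matrix.mulVec_mulVec, h,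
      Matrix.mulVec_smul, smul_smul]
  have h2 := star_mulVec_dotProduct_mulVec (pauli_unitary a b) ψ (weyl a' b' *ᵥ ψ)
  rw [h1, h, star_smul, smul_dotProduct, dotProduct_smul, smul_eq_mul, smul_eq_mul] at h2
  have hq : χ (b * a' - b' * a) ≠ 1 := fun hq => hab <| ZMod.injective_stdAddChar <| by
    rw [hq, AddChar.map_zero_eq_one]
  have h3 : (χ (b * a' - b' * a) - 1) * (star ψ ⬝ᵥ (weyl a' b' *ᵥ ψ)) = 0 := by
    linear_combination h2 - χ (b * a' - b' * a) * (star ψ ⬝ᵥ (weyl a' b' *ᵥ ψ)) * hl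
  exact (mul_eq_zero.1 h3).resolve_left (sub_ne_zero.2 hq)

lemma basisLabel_det_ne_zero {i i' : Fin (d + 1)} (h : i' ≠ i) :
    (basisLabel i).2 * (basisLabel i').1 - (basisLabel i').2 * (basisLabel i).1 ≠ (0 : ZMod d) := by
  induction i using Fin.cases with
  | zero =>
    induction i' using Fin.cases with
    | zero => exact absurd rfl h
    | succ j' => simp [basisLabel]
  | succ j =>
    induction i' using Fin.cases with
    | zero => simp [basisLabel]
    | succ j' =>
      simp only [basisLabel, Fin.cons_succ, mul_one]
      intro h0
      refine h (congrArg Fin.succ (Fin.ext ?_))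
      have := congrArg ZMod.val (sub_eq_zero.1 h0)
      rwa [ZMod.val_cast_of_lt j.2, ZMod.val_cast_of_lt j'.2, eq_comm] at this

lemma basisLabel_ne_zero (i : Fin (d + 1)) :
    ¬((basisLabel i).1 = (0 : ZMod d) ∧ (basisLabel i).2 = (0 : ZMod d)) := by
  induction i using Fin.cases <;> simp [basisLabel]

lemma exists_eq_mul_basisLabel {a b : ZMod d} (h : ¬(a = 0 ∧ b = 0)) :
    ∃ (i : Fin (d + 1)) (n : ZMod d), n ≠ 0 ∧ a = n * (basisLabel i).1 ∧
      b = n * (basisLabel i).2 := by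
  by_cases ha : a = 0
  · exact ⟨0, b, fun hb => h ⟨ha, hb⟩, by simp [basisLabel, ha], by simp [basisLabel]⟩
  · refine ⟨Fin.succ ⟨(b / a).val, ZMod.val_lt _⟩, a, ha, ?_, ?_⟩
    · simp only [basisLabel, Fin.cons_succ, mul_one]
    · simp only [basisLabel, Fin.cons_succ, ZMod.natCast_zmod_val]
      field_simp

lemma trace_mul_basisProj (M : Op d) (i : Fin (d + 1)) (k : ZMod d) :
    (M * basisProj i k).trace = (1 / d : ℂ) * ∑ m : ZMod d, χ (-(m * k)) *
      (M * pauli d (basisLabel i).1 (basisLabel i).2 ^ m.val).trace := by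
  simp only [basisProj, proj_eq_sum, Matrix.mul_smul, Matrix.mul_sum, Matrix.trace_smul,
    Matrix.trace_sum, smul_eq_mul]

lemma trace_basisProj (i : Fin (d + 1)) (k : ZMod d) : (basisProj i k).trace = 1 := by
  have h := trace_mul_basisProj 1 i k
  rw [one_mul] at h
  rw [h, Finset.sum_eq_single 0 _ (by simp)]
  · simp [ZMod.card]
  · intro m _ hm
    obtain ⟨c, -, hc⟩ :=
      exists_pauli_pow_eq_smul_weyl (d := d) (basisLabel i).1 (basisLabel i).2 m.val
    have : ¬(m * (basisLabel i).1 = 0 ∧ m * (basisLabel i).2 = 0) := fun h =>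
      basisLabel_ne_zero i ⟨(mul_eq_zero.1 h.1).resolve_left hm,
        (mul_eq_zero.1 h.2).resolve_left hm⟩
    rw [one_mul, hc, ZMod.natCast_zmod_val, Matrix.trace_smul, trace_weyl, if_neg this, smul_zero,
      mul_zero]

lemma sum_basisProj (i : Fin (d + 1)) : ∑ k, basisProj i k = (1 : Op d) := by
  simp only [basisProj, proj_eq_sum, ← Finset.smul_sum]
  rw [Finset.sum_comm]
  simp only [← Finset.sum_smul, ← mul_neg, mul_comm _ (-_ : ZMod d)]
  have : ∀ m : ZMod d, ∑ k, χ (-k * m) = if m = 0 then (d : ℂ) else 0 := fun m => by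
    rw [← sum_stdAddChar_mul m]
    exact Fintype.sum_equiv (Equiv.neg _) _ _ fun _ => rfl
  simp only [this]
  rw [Finset.sum_eq_single 0 (fun m _ hm => by rw [if_neg hm, zero_smul]) (by simp)]
  simp [smul_smul]

/-- Unbiasedness: every nontrivial power of the other Pauli operator has zero expectation, leaving
only the `m = 0` term. -/
lemma trace_vecMulVec_mul_basisProj_of_ne {ψ : ZMod d → ℂ} (hψ : star ψ ⬝ᵥ ψ = 1)
    {i i' : Fin (d + 1)} {l : ℂ}
    (h : pauli d (basisLabel i).1 (basisLabel i).2 *ᵥ ψ = l • ψ) (hi : i' ≠ i) (k : ZMod d) :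
    (Matrix.vecMulVec ψ (star ψ) * basisProj i' k).trace = 1 / d := by
  rw [trace_mul_basisProj, Finset.sum_eq_single 0 _ (by simp)]
  · simp [hψ, dotProduct_comm ψ]
  · intro m _ hm
    obtain ⟨c, -, hc⟩ :=
      exists_pauli_pow_eq_smul_weyl (d := d) (basisLabel i').1 (basisLabel i').2 m.val
    rw [hc, ZMod.natCast_zmod_val, trace_vecMulVec_star_mul, Matrix.smul_mulVec, dotProduct_smul,
      expectation_weyl_eq_zero hψ h, smul_zero, mul_zero]
    have := mul_ne_zero hm (basisLabel_det_ne_zero hi)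
    convert this using 1
    ring

lemma trace_vecMulVec_mul_basisProj_same {ψ : ZMod d → ℂ} (hψ : star ψ ⬝ᵥ ψ = 1)
    {i : Fin (d + 1)} {k : ZMod d}
    (h : pauli d (basisLabel i).1 (basisLabel i).2 *ᵥ ψ = χ k • ψ) (k' : ZMod d) :
    (Matrix.vecMulVec ψ (star ψ) * basisProj i k').trace = if k = k' then 1 else 0 := by
  have h1 : ∀ m : ZMod d, χ (-(m * k')) * χ k ^ m.val = χ (m * (k - k')) := fun m => by
    rw [← AddChar.map_nsmul_eq_pow, nsmul_eq_mul, ZMod.natCast_zmod_val,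
      ← AddChar.map_add_eq_mul]
    congr 1
    ring
  rw [trace_mul_basisProj]
  simp only [trace_vecMulVec_star_mul, pow_mulVec_eigenvector h, dotProduct_smul, hψ, smul_eq_mul,
    mul_one, h1, sum_stdAddChar_mul, sub_eq_zero]
  split_ifs
  · rw [one_div, inv_mul_cancel₀ natCast_ne_zero_complex]
  · rw [mul_zero]

/-- In the frame identity for `|ψ⟩⟨ψ|`, each of the `d` other bases contributes `I / d`, which
together cancel the trace term; the eigenvector's own basis leaves a single projector. No separate
argument that the eigenspace is one-dimensional is needed. -/
lemma vecMulVec_eq_basisProj {ψ : ZMod d → ℂ} (hψ : star ψ ⬝ᵥ ψ = 1) {i : Fin (d + 1)} {k : ZMod d}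
    (h : pauli d (basisLabel i).1 (basisLabel i).2 *ᵥ ψ = χ k • ψ) :
    Matrix.vecMulVec ψ (star ψ) = basisProj i k := by
  have h0 := sum_trace_basisProj_smul (Matrix.vecMulVec ψ (star ψ))
  rw [Matrix.trace_vecMulVec, dotProduct_comm, hψ, one_smul,
    ← Finset.add_sum_erase _ _ (Finset.mem_univ i)] at h0
  have h1 : ∀ i' ∈ Finset.univ.erase i, ∑ k', (Matrix.vecMulVec ψ (star ψ) *
      basisProj i' k').trace • basisProj i' k' = (1 / d : ℂ) • (1 : Op d) := fun i' hi' => by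
    simp only [trace_vecMulVec_mul_basisProj_of_ne hψ h (Finset.ne_of_mem_erase hi'),
      ← Finset.smul_sum, sum_basisProj]
  rw [Finset.sum_congr rfl h1] at h0
  simp only [trace_vecMulVec_mul_basisProj_same hψ h, ite_smul, one_smul, zero_smul,
    Finset.sum_ite_eq, Finset.mem_univ, if_true, Finset.sum_const,
    Finset.card_erase_of_mem, Finset.card_univ, Fintype.card_fin, add_tsub_cancel_right] at h0
  rw [← Nat.cast_smul_eq_nsmul ℂ, smul_smul, mul_one_div_cancel natCast_ne_zero_complex,
    one_smul] at h0
  exact (add_right_cancel h0).symm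

lemma stdAddChar_smul_pauli_pow_d (k a b : ZMod d) : (χ k • pauli d a b) ^ d = 1 := by
  rw [smul_pow, pauli_pow_d, ← AddChar.map_nsmul_eq_pow]
  simp

/-- The projector is the average of the powers of `V = χ(-k) P`, and `V ^ d = 1` makes this average
invariant under `V`. -/
lemma pauli_mul_basisProj (i : Fin (d + 1)) (k : ZMod d) :
    pauli d (basisLabel i).1 (basisLabel i).2 * basisProj i k = χ k • basisProj i k := by
  set P := pauli d (basisLabel i).1 (basisLabel i).2 with hP
  set V := χ (-k) • P with hV
  have hVd : V ^ d = 1 := stdAddChar_smul_pauli_pow_d _ _ _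
  have hQ : basisProj i k = (1 / d : ℂ) • ∑ m ∈ Finset.range d, V ^ m := by
    rw [basisProj, proj]
    congr 1
    refine Finset.sum_congr rfl fun m _ => ?_
    rw [hV, smul_pow, mul_comm, pow_mul, omega_pow_eq_stdAddChar, ZMod.natCast_zmod_val,
      AddChar.map_neg_eq_inv, inv_pow]
  have hVQ : V * basisProj i k = basisProj i k := by
    have := mul_geom_sum V d
    rw [hVd, sub_self, sub_mul, one_mul, sub_eq_zero] at this
    rw [hQ, mul_smul_comm, this]
  have hPV : P = χ k • V := by
    rw [hV, smul_smul, mul_comm, stdAddChar_neg_mul_self, one_smul]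
  rw [hPV, smul_mul_assoc, hVQ]

/-- Any nonzero column of the projector, normalized, will do; one exists because the trace is `1`.
-/
lemma exists_eigenvector (i : Fin (d + 1)) (k : ZMod d) :
    ∃ ψ : ZMod d → ℂ, star ψ ⬝ᵥ ψ = 1 ∧
      pauli d (basisLabel i).1 (basisLabel i).2 *ᵥ ψ = χ k • ψ := by
  have h0 : basisProj i k ≠ 0 := fun h => by
    have := trace_basisProj i k
    simp [h] at this
  obtain ⟨y, hy⟩ : ∃ y, (fun x => basisProj i k x y) ≠ 0 := by
    by_contra! h
    exact h0 (Matrix.ext fun x y => congrFun (h y) x)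
  set φ := fun x => basisProj i k x y with hφ
  have hφ' : pauli d (basisLabel i).1 (basisLabel i).2 *ᵥ φ = χ k • φ := by
    ext x
    exact congrFun (congrFun (pauli_mul_basisProj i k) x) y
  have hpos : 0 < star φ ⬝ᵥ φ := Matrix.dotProduct_star_self_pos_iff.2 hy
  obtain ⟨hre, him⟩ := Complex.pos_iff.1 hpos
  set r := (star φ ⬝ᵥ φ).re with hr
  have hr' : star φ ⬝ᵥ φ = (r : ℂ) := Complex.ext rfl (by simpa using him.symm)
  refine ⟨((Real.sqrt r)⁻¹ : ℝ) • φ, ?_, ?_⟩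
  · rw [star_smul, smul_dotProduct, dotProduct_smul, hr', star_trivial, smul_smul,
      Complex.real_smul, ← Complex.ofReal_mul, ← mul_inv, Real.mul_self_sqrt hre.le,
      inv_mul_cancel₀ hre.ne', Complex.ofReal_one]
  · rw [Matrix.mulVec_smul, hφ', smul_comm]

/-! ### Stabilizer states are the vectors of the `d + 1` bases -/

lemma exists_eq_stdAddChar {l : ℂ} (hl : l ^ d = 1) : ∃ k : ZMod d, l = χ k := by
  have hd : d ≠ 0 := (Fact.out : d.Prime).ne_zero
  obtain ⟨n, -, hn⟩ := (Complex.isPrimitiveRoot_exp d hd).eq_pow_of_pow_eq_one hl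
  exact ⟨n, by rw [← hn, ← omega_pow_eq_stdAddChar, omega]⟩

lemma IsStabilizerVector.exists_eigenvalue {ψ : ZMod d → ℂ} (h : IsStabilizerVector ψ) :
    ∃ (i : Fin (d + 1)) (k : ZMod d),
      pauli d (basisLabel i).1 (basisLabel i).2 *ᵥ ψ = χ k • ψ := by
  obtain ⟨hψ, S, hS, ⟨g, hg1, rfl⟩, -, hfix⟩ := h
  have hψ0 : ψ ≠ 0 := fun h => by simp [h] at hψ
  have hg := Subgroup.mem_zpowers g
  obtain ⟨a, b, c, hgab⟩ := hS g hg
  have hgψ := hfix g hg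
  -- Otherwise the generator is a scalar fixing a nonzero vector, hence the identity.
  have hab : ¬(a = 0 ∧ b = 0) := by
    rintro ⟨rfl, rfl⟩
    have hP : pauli d 0 0 = 1 := by simp [pauli]
    rw [hP] at hgab
    rw [hgab, Matrix.smul_mulVec, Matrix.one_mulVec] at hgψ
    have hc : omega d ^ c.val = 1 := by
      have h2 : (omega d ^ c.val - 1) • ψ = 0 := by rw [sub_smul, one_smul, hgψ, sub_self]
      exact sub_eq_zero.1 ((smul_eq_zero.1 h2).resolve_right hψ0)
    exact hg1 (Units.ext (by rw [hgab, hc, one_smul, Units.val_one]))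
  obtain ⟨i, n, hn, ha, hb⟩ := exists_eq_mul_basisLabel hab
  -- Raising the generator to the power `n⁻¹` moves its label from `n • basisLabel i` to `basisLabel
  -- i`, up to a phase.
  obtain ⟨e, he, hpow⟩ : ∃ e : ℂ, star e * e = 1 ∧
      (g : Op d) ^ (n⁻¹).val = e • weyl (basisLabel i).1 (basisLabel i).2 := by
    obtain ⟨e₁, he₁, h₁⟩ := exists_pauli_eq_smul_weyl a b
    obtain ⟨e₂, he₂, h₂⟩ := exists_smul_weyl_pow (omega d ^ c.val * e₁) (by
      rw [star_mul', star_pow, mul_mul_mul_comm, ← mul_pow, star_omega, one_pow, he₁, one_mul])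
      a b (n⁻¹).val
    refine ⟨e₂, he₂, ?_⟩
    rw [hgab, h₁, smul_smul, h₂, ZMod.natCast_zmod_val, ha, hb, inv_mul_cancel_left₀ hn,
      inv_mul_cancel_left₀ hn]
  have hfix' : (g : Op d) ^ (n⁻¹).val *ᵥ ψ = ψ := by
    simpa using pow_mulVec_eigenvector (l := 1) (by rw [hgψ, one_smul]) (n⁻¹).val
  obtain ⟨e', -, hP⟩ := exists_pauli_eq_smul_weyl (d := d) (basisLabel i).1 (basisLabel i).2
  have hPψ : pauli d (basisLabel i).1 (basisLabel i).2 *ᵥ ψ = (e' * star e) • ψ := by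
    rw [hpow, Matrix.smul_mulVec] at hfix'
    conv_rhs => rw [← hfix']
    rw [hP, Matrix.smul_mulVec, smul_smul, mul_assoc, he, mul_one]
  have hl : (e' * star e) ^ d = 1 := by
    have h2 := pow_mulVec_eigenvector hPψ d
    rw [pauli_pow_d, Matrix.one_mulVec] at h2
    have h3 : ((e' * star e) ^ d - 1) • ψ = 0 := by rw [sub_smul, one_smul, ← h2, sub_self]
    exact sub_eq_zero.1 ((smul_eq_zero.1 h3).resolve_right hψ0)
  obtain ⟨k, hk⟩ := exists_eq_stdAddChar hl
  exact ⟨i, k, hk ▸ hPψ⟩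

lemma pow_mem_pauliSet (k a b : ZMod d) {m : ℕ} (hm : m < d) :
    (χ k • pauli d a b) ^ m ∈ pauliSet d := by
  -- For `d = 2` the prefactor `i^(ab)` is not a power of `ω` in general, but only the powers `0`
  -- and `1` occur. Otherwise there is no prefactor and all Weyl phases are powers of `ω`.
  by_cases h2 : d = 2
  · obtain rfl | rfl : m = 0 ∨ m = 1 := by omega
    · exact ⟨0, 0, 0, by simp [pauli]⟩
    · exact ⟨a, b, k, by rw [pow_one, omega_pow_eq_stdAddChar, ZMod.natCast_zmod_val]⟩
  · have hP : ∀ a b : ZMod d, pauli d a b = weyl a b := fun a b => by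
      rw [pauli, if_neg h2, one_smul, shiftX_pow_mul_clockZ_pow]
    suffices ∀ m : ℕ, ∃ c : ZMod d, (χ k • weyl a b) ^ m = χ c • weyl ((m : ZMod d) * a) (m * b) by
      obtain ⟨c, hc⟩ := this m
      exact ⟨m * a, m * b, c, by
        rw [hP, hP, omega_pow_eq_stdAddChar, ZMod.natCast_zmod_val]; exact hc⟩
    intro m
    induction m with
    | zero => exact ⟨0, by simp [weyl_zero_zero]⟩
    | succ m ih =>
      obtain ⟨c, hc⟩ := ih
      refine ⟨c + k + m * b * a, ?_⟩
      rw [pow_succ, hc, smul_mul_smul_comm, weyl_mul, smul_smul, ← AddChar.map_add_eq_mul,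
        ← AddChar.map_add_eq_mul]
      congr 2 <;> push_cast <;> ring

lemma isStabilizerVector_of_eigenvector {ψ : ZMod d → ℂ} (hψ : star ψ ⬝ᵥ ψ = 1) {i : Fin (d + 1)}
    {k : ZMod d} (h : pauli d (basisLabel i).1 (basisLabel i).2 *ᵥ ψ = χ k • ψ) :
    IsStabilizerVector ψ := by
  classical
  set V := χ (-k) • pauli d (basisLabel i).1 (basisLabel i).2 with hV
  have hVd : V ^ d = 1 := stdAddChar_smul_pauli_pow_d _ _ _
  have hVψ : V *ᵥ ψ = (1 : ℂ) • ψ := by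
    rw [hV, Matrix.smul_mulVec, h, smul_smul, stdAddChar_neg_mul_self]
  set g : (Op d)ˣ := Units.ofPowEqOne V d hVd (Fact.out : d.Prime).ne_zero with hg
  have hgV : (g : Op d) = V := rfl
  have hgd : g ^ d = 1 := Units.ext (by simpa [hgV] using hVd)
  -- A Pauli operator with nonzero label is traceless, whereas the identity has trace `d`. Primality
  -- of `d` then makes the order exactly `d`.
  have hg1 : g ≠ 1 := fun h1 => by
    have h2 : V.trace = d := by
      rw [← hgV, h1, Units.val_one, Matrix.trace_one, ZMod.card]
    obtain ⟨c, -, hP⟩ := exists_pauli_eq_smul_weyl (d := d) (basisLabel i).1 (basisLabel i).2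
    rw [hV, hP, Matrix.trace_smul, Matrix.trace_smul, trace_weyl, if_neg (basisLabel_ne_zero i),
      smul_zero, smul_zero] at h2
    exact natCast_ne_zero_complex h2.symm
  have hord : orderOf g = d := orderOf_eq_prime hgd hg1
  have hmem : ∀ x ∈ Subgroup.zpowers g, ∃ m < d, (x : Op d) = V ^ m := fun x hx => by
    have hfin : IsOfFinOrder g :=
      isOfFinOrder_iff_pow_eq_one.2 ⟨d, (Fact.out : d.Prime).pos, hgd⟩
    rw [hfin.mem_zpowers_iff_mem_range_orderOf, hord, Finset.mem_image] at hx
    obtain ⟨m, hm, rfl⟩ := hx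
    exact ⟨m, Finset.mem_range.1 hm, by rw [Units.val_pow_eq_pow_val, hgV]⟩
  refine ⟨hψ, Subgroup.zpowers g, fun x hx => ?_, ⟨g, hg1, rfl⟩, ?_, fun x hx => ?_⟩
  · obtain ⟨m, hm, hxm⟩ := hmem x hx
    rw [hxm]
    exact pow_mem_pauliSet _ _ _ hm
  · rw [Nat.card_zpowers, hord]
  · obtain ⟨m, -, hxm⟩ := hmem x hx
    rw [hxm, pow_mulVec_eigenvector hVψ, one_pow, one_smul]

lemma stabilizerHull_eq :
    stabilizerHull d = convexHull ℝ {M | ∃ (i : Fin (d + 1)) (k : ZMod d), M = basisProj i k} := by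
  rw [stabilizerHull]
  congr 1
  ext M
  constructor
  · rintro ⟨ψ, hψ, rfl⟩
    obtain ⟨i, k, h⟩ := hψ.exists_eigenvalue
    exact ⟨i, k, vecMulVec_eq_basisProj hψ.1 h⟩
  · rintro ⟨i, k, rfl⟩
    obtain ⟨ψ, hψ, h⟩ := exists_eigenvector i k
    exact ⟨ψ, isStabilizerVector_of_eigenvector hψ h, (vecMulVec_eq_basisProj hψ h).symm⟩

lemma trace_basisProj_mul_basisProj (i i' : Fin (d + 1)) (k k' : ZMod d) :
    (basisProj i k * basisProj i' k').trace =
      if i' = i then (if k = k' then 1 else 0) else 1 / (d : ℂ) := by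
  obtain ⟨ψ, hψ, h⟩ := exists_eigenvector i k
  rw [← vecMulVec_eq_basisProj hψ h]
  split_ifs with hi hk
  · rw [hi, trace_vecMulVec_mul_basisProj_same hψ h, if_pos hk]
  · rw [hi, trace_vecMulVec_mul_basisProj_same hψ h, if_neg hk]
  · exact trace_vecMulVec_mul_basisProj_of_ne hψ h hi k'

/-! ### Wigner values and the facets of the stabilizer hull -/

lemma wigner_eq (M : Op d) (u : Fin (d + 1) → ZMod d) :
    wigner M u = 1 / d * (∑ i, (M * basisProj i (u i)).trace.re - M.trace.re) := by
  have h : (M * phasePoint d u).trace =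
      ((1 / d : ℝ) : ℂ) * (∑ i, (M * basisProj i (u i)).trace - M.trace) := by
    simp [phasePoint_eq, mul_sub, Matrix.mul_sum, Matrix.trace_sum]
  rw [wigner, h, Complex.re_ofReal_mul, Complex.sub_re, Complex.re_sum]

lemma wigner_add (M N : Op d) (u : Fin (d + 1) → ZMod d) :
    wigner (M + N) u = wigner M u + wigner N u := by
  simp [wigner, add_mul]

lemma wigner_smul (t : ℝ) (M : Op d) (u : Fin (d + 1) → ZMod d) :
    wigner (t • M) u = t * wigner M u := by
  simp [wigner]

lemma wigner_maximallyMixed (u : Fin (d + 1) → ZMod d) :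
    wigner ((1 / d : ℂ) • (1 : Op d)) u = 1 / (d : ℝ) ^ 2 := by
  have hd : (d : ℝ) ≠ 0 := by exact_mod_cast (Fact.out : d.Prime).ne_zero
  have h1 : (1 / d : ℂ) = ((1 / d : ℝ) : ℂ) := by push_cast; rfl
  rw [h1, Complex.coe_smul, wigner_smul, wigner_eq]
  simp only [one_mul, trace_basisProj, Matrix.trace_one, ZMod.card, Complex.one_re,
    Finset.sum_const, Finset.card_univ, Fintype.card_fin, Complex.natCast_re]
  rw [nsmul_eq_mul]
  push_cast
  field_simp
  ring

lemma wigner_depolarize (p : ℝ) (M : Op d) (u : Fin (d + 1) → ZMod d) :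
    wigner (depolarize p M) u = (1 - p) * wigner M u + p / (d : ℝ) ^ 2 := by
  rw [depolarize, wigner_add, wigner_smul, wigner_smul, wigner_maximallyMixed, mul_one_div]

/-- The `d` other bases contribute `1 / d` each, cancelling the subtracted trace; what remains is an
overlap equal to `0` or `1`. -/
lemma wigner_basisProj_nonneg (i : Fin (d + 1)) (k : ZMod d) (u : Fin (d + 1) → ZMod d) :
    0 ≤ wigner (basisProj i k) u := by
  have hd : (d : ℝ) ≠ 0 := by exact_mod_cast (Fact.out : d.Prime).ne_zero
  rw [wigner_eq, trace_basisProj, Complex.one_re]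
  refine mul_nonneg (by positivity) (sub_nonneg.2 ?_)
  rw [← Finset.add_sum_erase _ _ (Finset.mem_univ i)]
  have h1 : ∀ i' ∈ Finset.univ.erase i,
      (basisProj i k * basisProj i' (u i')).trace.re = 1 / (d : ℝ) := fun i' hi' => by
    rw [trace_basisProj_mul_basisProj, if_neg (Finset.ne_of_mem_erase hi')]
    simp
  have h2 : 0 ≤ (basisProj i k * basisProj i (u i)).trace.re := by
    rw [trace_basisProj_mul_basisProj, if_pos rfl]
    split_ifs <;> simp
  rw [Finset.sum_congr rfl h1, Finset.sum_const, Finset.card_erase_of_mem (Finset.mem_univ i),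
    Finset.card_univ, Fintype.card_fin, add_tsub_cancel_right, nsmul_eq_mul,
    mul_one_div_cancel hd]
  linarith

lemma wigner_nonneg_of_mem_stabilizerHull {M : Op d} (hM : M ∈ stabilizerHull d)
    (u : Fin (d + 1) → ZMod d) : 0 ≤ wigner M u := by
  rw [stabilizerHull_eq] at hM
  refine convexHull_min (t := {M : Op d | 0 ≤ wigner M u}) ?_ ?_ hM
  · rintro _ ⟨i, k, rfl⟩
    exact wigner_basisProj_nonneg i k u
  · intro M hM N hN s t hs ht _
    simp only [Set.mem_ofPred_eq, wigner_add, wigner_smul] at *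
    positivity

/-- The frame coefficients of `M + I` are turned into convex weights for `M` by adding a constant in
each basis, the constants summing to `-1`. -/
lemma mem_stabilizerHull_of_wigner_nonneg {M : Op d} (hM : M.IsHermitian) (htr : M.trace = 1)
    (hW : ∀ u, 0 ≤ wigner M u) : M ∈ stabilizerHull d := by
  have hd : (0 : ℝ) < d := by exact_mod_cast (Fact.out : d.Prime).pos
  set r : Fin (d + 1) → ZMod d → ℝ := fun i k => (M * basisProj i k).trace.re with hr
  have hreal : ∀ i k, (M * basisProj i k).trace = r i k := fun i k => by
    refine (Complex.conj_eq_iff_re.1 ?_).symm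
    rw [← Complex.star_def, ← Matrix.trace_conjTranspose, Matrix.conjTranspose_mul, basisProj,
      proj_isHermitian, hM, Matrix.trace_mul_comm]
  -- The tightest inequality comes from the `u` that minimizes the coefficient in each basis
  -- separately; its slack `s` is `d` times the Wigner value there.
  choose u hu using fun i => Finite.exists_min (r i)
  set s := ∑ i, r i (u i) - 1 with hs
  have hs0 : 0 ≤ s := by
    have := hW u
    rw [wigner_eq, htr, Complex.one_re] at this
    exact nonneg_of_mul_nonneg_right this (by positivity)
  -- Subtracting each basis minimum removes `s + 1` in total, one unit being required; the surplus
  -- `s` is returned to basis `0`, an arbitrary choice.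
  set t : Fin (d + 1) → ℝ := fun i => (if i = 0 then s else 0) - r i (u i) with ht
  have ht1 : ∑ i, t i = -1 := by
    simp only [ht, Finset.sum_sub_distrib, Finset.sum_ite_eq', Finset.mem_univ, if_true, hs]
    ring
  set w : Fin (d + 1) × ZMod d → ℝ := fun x => r x.1 x.2 + t x.1 with hw
  have hw0 : ∀ x, 0 ≤ w x := fun x => by
    have h1 := hu x.1 x.2
    have h2 : 0 ≤ if x.1 = 0 then s else 0 := by split_ifs <;> simp [hs0]
    simp only [hw, ht]
    linarith
  have hsum : ∑ x, w x • basisProj x.1 x.2 = M := by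
    rw [Fintype.sum_prod_type]
    simp only [hw, add_smul, Finset.sum_add_distrib, ← Finset.smul_sum, sum_basisProj]
    have h1 := sum_trace_basisProj_smul M
    simp only [hreal, Complex.coe_smul, htr, one_smul] at h1
    rw [h1, ← Finset.sum_smul, ht1, neg_one_smul, add_neg_cancel_right]
  have hone : ∑ x, w x = 1 := by
    have h1 := congrArg Matrix.trace hsum
    rw [htr, Matrix.trace_sum] at h1
    simp only [Matrix.trace_smul, trace_basisProj, Complex.real_smul, mul_one] at h1
    exact_mod_cast h1
  rw [stabilizerHull_eq, ← hsum]
  exact (convex_convexHull ℝ _).sum_mem (fun x _ => hw0 x) hone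
    fun x _ => subset_convexHull ℝ _ ⟨x.1, x.2, rfl⟩

/-! ### The noise threshold -/

lemma depolarize_mem_stabilizerHull_iff {ρ : Op d} (hρ : IsState ρ) (p : ℝ) :
    depolarize p ρ ∈ stabilizerHull d ↔ ∀ u, 0 ≤ (1 - p) * wigner ρ u + p / (d : ℝ) ^ 2 := by
  simp only [← wigner_depolarize]
  refine ⟨wigner_nonneg_of_mem_stabilizerHull, mem_stabilizerHull_of_wigner_nonneg ?_ ?_⟩
  · rw [Matrix.IsHermitian, depolarize]
    simp [Matrix.conjTranspose_smul, hρ.1.isHermitian.eq]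
  · simp only [depolarize, Matrix.trace_add, Matrix.trace_smul, hρ.2, Matrix.trace_one, ZMod.card,
      smul_eq_mul, one_div, inv_mul_cancel₀ natCast_ne_zero_complex, Complex.real_smul]
    push_cast
    ring

lemma isLeast_stabilizingRates {ρ : Op d} (hρ : IsState ρ) :
    IsLeast (stabilizingRates ρ) (1 - 1 / ((d : ℝ) ^ 2 * negativity ρ + 1)) := by
  have hd : (0 : ℝ) < (d : ℝ) ^ 2 := by
    have := (Fact.out : d.Prime).pos
    positivity
  by_cases h : ∀ u, 0 ≤ wigner ρ u
  · rw [negativity, if_pos h, mul_zero, zero_add, div_one, sub_self]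
    refine ⟨⟨le_rfl, zero_le_one, ?_⟩, fun p hp => hp.1⟩
    rw [depolarize_mem_stabilizerHull_iff hρ]
    simpa using h
  · rw [negativity, if_neg h]
    obtain ⟨u₀, -, hu₀⟩ := Finset.exists_mem_eq_inf' Finset.univ_nonempty (wigner ρ)
    have hmin : ∀ u, wigner ρ u₀ ≤ wigner ρ u := fun u =>
      hu₀.symm.le.trans <| Finset.inf'_le _ (Finset.mem_univ u)
    push Not at h
    obtain ⟨u₁, hu₁⟩ := h
    rw [hu₀, abs_of_neg ((hmin u₁).trans_lt hu₁)]
    obtain ⟨n, hn⟩ : ∃ n, n = -wigner ρ u₀ := ⟨_, rfl⟩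
    have hn0 : 0 < n := by linarith [hmin u₁]
    rw [← hn]
    have hD : 0 < (d : ℝ) ^ 2 * n + 1 := by positivity
    refine ⟨⟨?_, ?_, ?_⟩, fun p hp => ?_⟩
    · rw [sub_nonneg, div_le_one hD]
      linarith [mul_pos hd hn0]
    · rw [sub_le_self_iff]
      positivity
    · rw [depolarize_mem_stabilizerHull_iff hρ]
      intro u
      have h1 : -n ≤ wigner ρ u := by linarith [hmin u]
      -- At the claimed rate the smallest Wigner value is lifted exactly to `0`; the others follow
      -- by monotonicity.
      have h2 : (1 - (1 - 1 / ((d : ℝ) ^ 2 * n + 1))) * -n +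
          (1 - 1 / ((d : ℝ) ^ 2 * n + 1)) / (d : ℝ) ^ 2 = 0 := by
        have hd0 : (d : ℝ) ≠ 0 := pow_ne_zero_iff two_ne_zero |>.1 hd.ne'
        field_simp
        ring
      rw [← h2]
      gcongr
      rw [sub_sub_cancel]
      positivity
    · have h1 := (depolarize_mem_stabilizerHull_iff hρ p).1 hp.2.2 u₀
      rw [show wigner ρ u₀ = -n by rw [hn, neg_neg]] at h1
      -- Clearing `d²` makes the condition at the minimizer linear in `p`, which avoids dividing by
      -- `1 - p`.
      have h2 : 0 ≤ (d : ℝ) ^ 2 * ((1 - p) * -n + p / (d : ℝ) ^ 2) := mul_nonneg hd.le h1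
      rw [mul_add, mul_div_cancel₀ _ hd.ne'] at h2
      rw [sub_le_comm, le_div_iff₀ hD]
      linarith

end QuditStab

end

theorem mainTheorem2 (d : ℕ) [Fact d.Prime] (ρ : QuditStab.Op d) (hρ : QuditStab.IsState ρ) :
    IsLeast (QuditStab.stabilizingRates ρ) (QuditStab.robustness ρ) ∧
      QuditStab.robustness ρ = 1 - 1 / ((d : ℝ) ^ 2 * QuditStab.negativity ρ + 1) := by
  have h := QuditStab.isLeast_stabilizingRates hρ
  have hr : QuditStab.robustness ρ = 1 - 1 / ((d : ℝ) ^ 2 * QuditStab.negativity ρ + 1) :=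
    h.csInf_eq
  exact ⟨hr ▸ h, hr⟩
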